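/- Let $H$ be a complex Hilbert space with inner product $(\cdot,\cdot)_H$ (linear in the first argument). For a bounded operator $T$ on $H$ and $j\ge 1$ let $\sigma_j(T):=\inf\{\|T-F\| : F \text{ bounded on } H,\ \operatorname{rank}F<j\}$ and $\overline\sigma_k(T):=\frac1k\sum_{j=1}^k\sigma_j(T)$. For $p>0$ put $|||T|||_p:=\big(\sum_{i\ge1}\sigma_i(T)^p\big)^{1/p}$ and let $\mathcal C^p(H)$ be the set of compact $T$ with $|||T|||_p<\infty$; let $\mathcal C^0(H)$ be the set of all compact operators on $H$. Let $p\ge 0$, let $A=I+K$ be a bounded operator on $H$ with $K\in\mathcal C^p(H)$, and let $b\in H$. Let $X_h,Y_h\subset H$ be subspaces of the same finite dimension $N$ with bases $(\varphi_i)_{i=1}^N$ of $X_h$ and $(\phi_i)_{i=1}^N$ of $Y_h$. Assume the discrete inf-sup conditions: there are constants $\gamma_A,\gamma_N>0$ such that for all $u\in X_h$ $$\sup_{0\ne v\in Y_h}\frac{|(Au,v)_H|}{\|v\|_H}\ \ge\ \gamma_A\|u\|_H,\qquad \sup_{0\ne v\in Y_h}\frac{|(u,v)_H|}{\|v\|_H}\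 \ge\ \gamma_N\|u\|_H .$$ Define the Galerkin matrix $\mathbf A=((A\varphi_j,\phi_i)_H)_{i,j}$, the mass matrix $\mathbf N=((\varphi_j,\phi_i)_H)_{i,j}$ and $\mathbf b=((b,\phi_i)_H)_i$. On $\mathbb C^N$ let $\|\cdot\|_2$ be the Euclidean norm and $\|\mathbf u\|_H:=(\mathbf H\mathbf u,\mathbf u)_2^{1/2}$ with $\mathbf H=((\varphi_j,\varphi_i)_H)_{i,j}$. Let $K_{\Lambda_h}:=\|\Lambda_h\|/\gamma_{\Lambda_h}$, where $\|\Lambda_h\|$ and $\gamma_{\Lambda_h}$ are the supremum and the infimum of $\|\sum_i u_i\varphi_i\|_H/\|\mathbf u\|_2$ over $\mathbf u\neq 0$. Apply GMRES to $\mathbf Q\mathbf u=\mathbf d$ with $\mathbf Q=\mathbf N^{-1}\mathbf A$, $\mathbf d=\mathbf N^{-1}\mathbf b$ and an initial guess $\mathbf x_0$ with $\mathbf r_0:=\mathbf d-\mathbf Q\mathbf x_0\ne0$. For $1\le k\le N$ let $\mathbf r_k=\mathbf d-\mathbf Q\mathbf x_k$ and $\tilde{\mathbf r}_k=\mathbf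 d-\mathbf Q\tilde{\mathbf x}_k$ be the residuals of the weighted and of the Euclidean GMRES iterates, that is, $\mathbf x_k$ and $\tilde{\mathbf x}_k$ minimize $\|\mathbf d-\mathbf Q\mathbf x\|_H$ and $\|\mathbf d-\mathbf Q\mathbf x\|_2$, respectively, over $\mathbf x\in\mathbf x_0+\operatorname{span}\{\mathbf Q^j\mathbf r_0:0\le j<k\}$. Then, for $1\le k\le N$, $$\Big(\frac{\|\mathbf r_k\|_H}{\|\mathbf r_0\|_H}\Big)^{1/k}\le\frac{\overline\sigma_k(K)}{\gamma_A\gamma_N},\qquad \Big(\frac{\|\tilde{\mathbf r}_k\|_2}{\|\mathbf r_0\|_2}\Big)^{1/k}\le K_{\Lambda_h}\frac{\overline\sigma_k(K)}{\gamma_A\gamma_N},$$ and, if $p>0$, $$\Big(\frac{\|\mathbf r_k\|_H}{\|\mathbf r_0\|_H}\Big)^{1/k}\le\frac{|||K|||_p}{\gamma_A\gamma_N}k^{-1/p},\qquad \Big(\frac{\|\tilde{\mathbf r}_k\|_2}{\|\mathbf r_0\|_2}\Big)^{1/k}\le K_{\Lambda_h}\frac{|||K|||_p}{\gamma_A\gamma_N}k^{-1/p}.$$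 If $p\ge1$, the bounds are moreover ordered: $\frac{\overline\sigma_k(K)}{\gamma_A\gamma_N}\le\frac{|||K|||_p}{\gamma_A\gamma_N}k^{-1/p}$ and $K_{\Lambda_h}\frac{\overline\sigma_k(K)}{\gamma_A\gamma_N}\le K_{\Lambda_h}\frac{|||K|||_p}{\gamma_A\gamma_N}k^{-1/p}$. -/

import Mathlib

noncomputable section

namespace BiParam

section Operators

variable {H : Type*} [NormedAddCommGroup H] [InnerProductSpace ℂ H]

/-- The `j`-th singular value (`j = 1, 2, …`) of a bounded operator: its distance, in operator
norm, to the operators of rank less than `j`. -/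
def singularValue (T : H →L[ℂ] H) (j : ℕ) : ℝ :=
  sInf {r : ℝ | ∃ F : H →L[ℂ] H, (F : H →ₗ[ℂ] H).rank < (j : Cardinal) ∧ r = ‖T - F‖}

/-- The arithmetic mean of the first `k` singular values. -/
def meanSingularValue (T : H →L[ℂ] H) (k : ℕ) : ℝ :=
  (1 / (k : ℝ)) * ∑ j ∈ Finset.Icc 1 k, singularValue T j

/-- The Carleman class of index `p`: compact operators with `p`-summable singular values; for
`p = 0` it is the class of all compact operators. -/
def IsCarleman (p : ℝ) (T : H →L[ℂ] H) : Prop :=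
  IsCompactOperator T ∧ (0 < p → Summable fun i : ℕ => singularValue T (i + 1) ^ p)

/-- The `ℓ^p` quasi-norm of the sequence of singular values. -/
def carlemanNorm (p : ℝ) (T : H →L[ℂ] H) : ℝ :=
  (∑' i : ℕ, singularValue T (i + 1) ^ p) ^ (1 / p)

/-- `p`-class Fredholm operators of the second kind. -/
def IsSecondKind (p : ℝ) (A : H →L[ℂ] H) : Prop :=
  IsCarleman p (A - ContinuousLinearMap.id ℂ H)

/-- The sesquilinear form `(u, v) ↦ (T u, v)` of an operator on `H`, linear in `u` and antilinear
in `v` (Mathlib's inner product is antilinear in its first argument). -/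
def form (T : H →L[ℂ] H) (u v : H) : ℂ := inner ℂ v (T u)

/-- The discrete inf-sup condition for the form of `T` on `Xh × Yh`, with constant `γ > 0`. -/
def DiscreteInfSup (T : H →L[ℂ] H) (Xh Yh : Submodule ℂ H) (γ : ℝ) : Prop :=
  0 < γ ∧ ∀ u ∈ Xh, γ * ‖u‖ ≤ ⨆ v : {v : H // v ∈ Yh ∧ v ≠ 0}, ‖form T u v‖ / ‖(v : H)‖

variable {N : ℕ} {Xh Yh : Submodule ℂ H}

/-- The Galerkin matrix of (the form of) `T` for the trial basis `φ` and the test basis `ϕ`. -/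
def galerkinMatrix (T : H →L[ℂ] H) (φ : Module.Basis (Fin N) ℂ Xh)
    (ϕ : Module.Basis (Fin N) ℂ Yh) : Matrix (Fin N) (Fin N) ℂ :=
  Matrix.of fun i j => form T (φ j : H) (ϕ i : H)

/-- The mass matrix: the Galerkin matrix of the identity. -/
def massMatrix (φ : Module.Basis (Fin N) ℂ Xh) (ϕ : Module.Basis (Fin N) ℂ Yh) :
    Matrix (Fin N) (Fin N) ℂ :=
  galerkinMatrix (ContinuousLinearMap.id ℂ H) φ ϕ

/-- The Galerkin right-hand side of the functional `v ↦ (b, v)`. -/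
def galerkinVector (b : H) (ϕ : Module.Basis (Fin N) ℂ Yh) : Fin N → ℂ :=
  fun i => inner ℂ (ϕ i : H) b

/-- The Euclidean norm on `ℂ^N`. -/
def euclideanNorm (u : Fin N → ℂ) : ℝ := ‖WithLp.toLp 2 u‖

/-- The norm `u ↦ √(G u, u)₂` on `ℂ^N` induced by `H`, where `G` is the Gram matrix of `φ`. -/
def energyNorm (φ : Module.Basis (Fin N) ℂ Xh) (u : Fin N → ℂ) : ℝ :=
  Real.sqrt (star u ⬝ᵥ (massMatrix φ φ).mulVec u).re

/-- The synthesis operator `u ↦ ∑ i, u i • φ i`. -/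
def synthesis (φ : Module.Basis (Fin N) ℂ Xh) (u : Fin N → ℂ) : H := ∑ i, u i • (φ i : H)

/-- The norm of the synthesis operator. -/
def synthesisNorm (φ : Module.Basis (Fin N) ℂ Xh) : ℝ :=
  ⨆ u : {u : Fin N → ℂ // u ≠ 0}, ‖synthesis φ u‖ / euclideanNorm (u : Fin N → ℂ)

/-- The lower bound of the synthesis operator. -/
def synthesisGamma (φ : Module.Basis (Fin N) ℂ Xh) : ℝ :=
  ⨅ u : {u : Fin N → ℂ // u ≠ 0}, ‖synthesis φ u‖ / euclideanNorm (u : Fin N → ℂ)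

/-- The condition number of the synthesis operator. -/
def synthesisCond (φ : Module.Basis (Fin N) ℂ Xh) : ℝ := synthesisNorm φ / synthesisGamma φ

end Operators

section Gmres

variable {N : ℕ}

/-- The Krylov space spanned by `Q ^ j r`, `0 ≤ j < k`. -/
def krylov (Q : Matrix (Fin N) (Fin N) ℂ) (r : Fin N → ℂ) (k : ℕ) : Submodule ℂ (Fin N → ℂ) :=
  Submodule.span ℂ ((fun j : ℕ => (Q ^ j).mulVec r) '' Set.Iio k)

/-- The residual of `x` for the system `Q x = d`. -/
def residual (Q : Matrix (Fin N) (Fin N) ℂ) (d x : Fin N → ℂ) : Fin N → ℂ := d - Q.mulVec x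

/-- `x` is the `k`-th iterate of (non-restarted) GMRES for the system `Q x = d` with initial guess
`x₀`, where residuals are minimized in the norm `nrm`. -/
def IsGmresIterate (nrm : (Fin N → ℂ) → ℝ) (Q : Matrix (Fin N) (Fin N) ℂ) (d x₀ : Fin N → ℂ)
    (k : ℕ) (x : Fin N → ℂ) : Prop :=
  x - x₀ ∈ krylov Q (residual Q d x₀) k ∧
    ∀ y : Fin N → ℂ, y - x₀ ∈ krylov Q (residual Q d x₀) k →
      nrm (residual Q d x) ≤ nrm (residual Q d y)

end Gmres

end BiParam

end

/-!
Let `B = P A` on the trial space, where `P` is the oblique projection of `H` onto the trial space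
along the annihilator of the test space (`petrovProj`). In the basis `φ` the matrix of `B` is
`Q = N⁻¹ A`, and the weighted norm of a coordinate vector is the norm of the vector it represents.
The two inf-sup conditions say that `γN ‖P w‖ ≤ ‖w‖` and `γA ‖u‖ ≤ ‖B u‖`; since `P` is the
identity on the trial space, `B - 1` is the restriction of `P K`, whose `j`-th approximation number
is at most `σ_j(K) / γN`.

The core is Moret's bound `‖r_k‖ ≤ ‖r_0‖ ∏ j ≤ k, σ_j(B - 1) / γA` for the minimal residual
(`exists_norm_krylov_residual_le`), proved by comparing volumes, that is, Gram determinants. With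
`w_j = B ^ j r_0`, the distance of `r_0` to the span of `w_1, …, w_k` is
`vol(w_0, …, w_k) / vol(w_1, …, w_k)`. Taking consecutive differences does not change the
numerator, so it equals `vol(w_0, (B - 1) w_0, …, (B - 1) w_{k-1})`, which is at most
`‖r_0‖ ∏ σ_j(B - 1) vol(w_0, …, w_{k-1})`; the denominator is at least
`γA ^ k vol(w_0, …, w_{k-1})`. Both estimates rest on `det_gram_map`: a linear map scales
top-dimensional volumes by the product of its singular values. If `w_0, …, w_{k-1}` are dependent,
the minimal residual vanishes.

The stated bounds follow from the inequality between the geometric mean and the power means. The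
Euclidean iterate is compared with the weighted one through the two bounds of the synthesis
operator, which costs `κ ^ (1 / k) ≤ κ` for the condition number `κ ≥ 1`.
-/

noncomputable section

namespace BiParam

open Matrix

/-! ### Gram determinants -/

section GramDeterminants

variable {E : Type*} [NormedAddCommGroup E] [InnerProductSpace ℂ E]

theorem gram_sum_smul {m n : Type*} [Fintype m] (x : m → E) (C : Matrix m n ℂ) :
    gram ℂ (fun j => ∑ i, C i j • x i) = Cᴴ * gram ℂ x * C := by
  ext i j
  simp only [gram_apply, sum_inner, inner_sum, inner_smul_left, inner_smul_right, mul_apply,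
    conjTranspose_apply, Finset.sum_mul, Finset.mul_sum, RCLike.star_def]
  exact Finset.sum_congr rfl fun a _ => Finset.sum_congr rfl fun b _ => by ring

theorem det_gram_sum_smul {m : Type*} [Fintype m] [DecidableEq m] (x : m → E)
    (C : Matrix m m ℂ) (hC : C.det = 1) :
    (gram ℂ (fun j => ∑ i, C i j • x i)).det = (gram ℂ x).det := by
  simp [gram_sum_smul, det_mul, det_conjTranspose, hC]

theorem det_gram_cons_of_orthogonal {k : ℕ} (u : E) (x : Fin k → E)
    (h : ∀ i, inner ℂ u (x i) = 0) :
    (gram ℂ (Fin.cons u x : Fin (k + 1) → E)).det = (‖u‖ ^ 2 : ℝ) * (gram ℂ x).det := by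
  rw [det_succ_row_zero, Fin.sum_univ_succ]
  simp only [gram_apply, Fin.cons_zero, Fin.cons_succ, h, mul_zero, zero_mul,
    Finset.sum_const_zero, add_zero, Fin.val_zero, pow_zero, one_mul]
  rw [inner_self_eq_norm_sq_to_K]
  push_cast
  congr 2

/-- Adding to the first vector a combination of the others is a shear, so it does not change the
Gram determinant. -/
theorem det_gram_cons_add {k : ℕ} (u : E) (x : Fin k → E) (c : Fin k → ℂ) :
    (gram ℂ (Fin.cons (u + ∑ i, c i • x i) x : Fin (k + 1) → E)).det =
      (gram ℂ (Fin.cons u x : Fin (k + 1) → E)).det := by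
  let C : Matrix (Fin (k + 1)) (Fin (k + 1)) ℂ :=
    of fun i j => Fin.cases (Fin.cases 1 c i) (fun j' => (1 : Matrix _ _ ℂ) i j'.succ) j
  have hC : C.det = 1 := by
    rw [det_of_isLowerTriangular]
    · rw [Fin.prod_univ_succ]
      simp [C]
    · intro i j hij
      replace hij : i < j := hij
      rcases Fin.eq_zero_or_eq_succ j with rfl | ⟨j, rfl⟩
      · simp at hij
      · have : i ≠ j.succ := hij.ne
        simp [C, one_apply, this]
  rw [← det_gram_sum_smul (Fin.cons u x) C hC]
  congr 2
  ext j
  rcases Fin.eq_zero_or_eq_succ j with rfl | ⟨j, rfl⟩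
  · simp [Fin.sum_univ_succ, C]
  · simp [C, one_apply]

/-- The Gram determinant of consecutive differences: the passage from `w` to its differences is
unitriangular. -/
theorem det_gram_cons_sub {k : ℕ} (w : ℕ → E) :
    (gram ℂ (Fin.cons (w 0) (fun j : Fin k => w (j + 1) - w j) : Fin (k + 1) → E)).det =
      (gram ℂ (fun j : Fin (k + 1) => w j)).det := by
  let C : Matrix (Fin (k + 1)) (Fin (k + 1)) ℂ :=
    of fun i j => (if i = j then 1 else 0) - (if (i : ℕ) + 1 = j then 1 else 0)
  have hC : C.det = 1 := by
    rw [det_of_isUpperTriangular]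
    · simp [C]
    · intro i j hij
      have h1 : i ≠ j := by rintro rfl; simp at hij
      have h2 : ¬ ((i : ℕ) + 1 = j) := by
        have : j < i := hij
        have := Fin.lt_def.1 this
        omega
      simp [C, h1, h2]
  rw [← det_gram_sum_smul (fun j : Fin (k + 1) => w j) C hC]
  congr 2
  ext j
  rcases Fin.eq_zero_or_eq_succ j with rfl | ⟨j, rfl⟩
  · simp [C]
  · have : ∀ i : Fin (k + 1), ((i : ℕ) + 1 = ((j.succ : Fin (k + 1)) : ℕ)) ↔ i = j.castSucc := by
      intro i
      simp [Fin.ext_iff]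
    simp only [C, of_apply, this, sub_smul, ite_smul, one_smul, zero_smul, Finset.sum_sub_distrib]
    simp

/-- Adjoining `u` to `x` multiplies the Gram determinant by the squared distance from `u` to the
span of `x`; the nearest point of the span has the coefficients `c`. -/
theorem exists_det_gram_cons {k : ℕ} (u : E) (x : Fin k → E) :
    ∃ c : Fin k → ℂ, ‖u - ∑ i, c i • x i‖ ≤ ‖u‖ ∧
      (gram ℂ (Fin.cons u x : Fin (k + 1) → E)).det =
        (‖u - ∑ i, c i • x i‖ ^ 2 : ℝ) * (gram ℂ x).det := by
  let S := Submodule.span ℂ (Set.range x)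
  have : FiniteDimensional ℂ S := FiniteDimensional.span_of_finite ℂ (Set.finite_range x)
  obtain ⟨c, hc⟩ :=
    (Submodule.mem_span_range_iff_exists_fun ℂ).1 (S.starProjection_apply_mem u)
  refine ⟨c, ?_, ?_⟩
  · rw [hc, ← Submodule.starProjection_orthogonal_val]
    exact Submodule.norm_starProjection_apply_le _ _
  · rw [← det_gram_cons_of_orthogonal, ← det_gram_cons_add (u - _) x c, sub_add_cancel]
    intro i
    rw [hc]
    exact Submodule.starProjection_inner_eq_zero u (x i) (Submodule.subset_span ⟨i, rfl⟩)

open scoped ComplexOrder in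
theorem det_gram_re_pos {k : ℕ} {x : Fin k → E} (hx : LinearIndependent ℂ x) :
    0 < (gram ℂ x).det.re :=
  (Complex.lt_def.1 (posDef_gram_of_linearIndependent hx).det_pos).1

end GramDeterminants

/-! ### Singular values of maps between finite-dimensional spaces -/

section SingularValues

variable {E F : Type*} [NormedAddCommGroup E] [InnerProductSpace ℂ E] [FiniteDimensional ℂ E]
  [NormedAddCommGroup F] [InnerProductSpace ℂ F] [FiniteDimensional ℂ F]

/-- The right singular vectors of `T` have orthogonal images, whose lengths are the singular
values. -/
theorem inner_map_eigenvectorBasis (T : E →ₗ[ℂ] F) {n : ℕ} (hn : Module.finrank ℂ E = n)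
    (i j : Fin n) :
    inner ℂ (T (T.isSymmetric_adjoint_comp_self.eigenvectorBasis hn i))
      (T (T.isSymmetric_adjoint_comp_self.eigenvectorBasis hn j)) =
      if i = j then ((T.singularValues i ^ 2 : ℝ) : ℂ) else 0 := by
  rw [← LinearMap.adjoint_inner_right, ← LinearMap.comp_apply,
    LinearMap.IsSymmetric.apply_eigenvectorBasis, inner_smul_right,
    OrthonormalBasis.inner_eq_ite, T.sq_singularValues_fin hn]
  split_ifs with h
  · subst h; simp
  · simp

/-- A linear map scales top-dimensional volumes by the product of its singular values. -/
theorem det_gram_map (T : E →ₗ[ℂ] F) {n : ℕ} (hn : Module.finrank ℂ E = n) (x : Fin n → E) :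
    (gram ℂ (fun i => T (x i))).det =
      ((∏ i : Fin n, T.singularValues i : ℝ) ^ 2 : ℝ) * (gram ℂ x).det := by
  let b := T.isSymmetric_adjoint_comp_self.eigenvectorBasis hn
  let M : Matrix (Fin n) (Fin n) ℂ := of fun i j => b.repr (x j) i
  have h1 : gram ℂ x = Mᴴ * M := gram_eq_conjTranspose_mul b x
  have h2 : (fun j => T (x j)) = fun j => ∑ i, M i j • T (b i) := by
    ext j
    rw [← b.sum_repr (x j)]
    simp [M]
  have h3 : gram ℂ (fun i => T (b i)) = diagonal fun i : Fin n =>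
      ((T.singularValues i ^ 2 : ℝ) : ℂ) := by
    ext i j
    rw [gram_apply, inner_map_eigenvectorBasis, diagonal_apply]
  rw [h2, gram_sum_smul, h3, h1, det_mul, det_mul, det_mul, det_diagonal, ← Finset.prod_pow]
  push_cast
  ring

theorem le_singularValues (T : E →ₗ[ℂ] F) {δ : ℝ} (hT : ∀ u, δ * ‖u‖ ≤ ‖T u‖) {n : ℕ}
    (hn : Module.finrank ℂ E = n) (i : Fin n) : δ ≤ T.singularValues i := by
  have h1 := inner_map_eigenvectorBasis T hn i i
  rw [if_pos rfl, inner_self_eq_norm_sq_to_K] at h1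
  have h2 : ‖T (T.isSymmetric_adjoint_comp_self.eigenvectorBasis hn i)‖ = T.singularValues i := by
    refine (sq_eq_sq₀ (norm_nonneg _) (T.singularValues_nonneg _)).1 ?_
    refine Complex.ofReal_injective ?_
    push_cast at h1 ⊢
    exact h1
  simpa [h2] using hT (T.isSymmetric_adjoint_comp_self.eigenvectorBasis hn i)

/-- Courant–Fischer: the first `j + 1` right singular vectors span a space of dimension `j + 1`, on
which `T` is bounded below by its singular value number `j`; a map of rank at most `j` vanishes
at some nonzero vector of it. -/
theorem singularValues_le_of_finrank_range_le {G : Type*} [AddCommGroup G] [Module ℂ G]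
    (T : E →ₗ[ℂ] F) (R : E →ₗ[ℂ] G) (j : ℕ) (c : ℝ)
    (hc : 0 ≤ c) (hR : Module.finrank ℂ (LinearMap.range R) ≤ j)
    (h : ∀ u, R u = 0 → ‖T u‖ ≤ c * ‖u‖) : T.singularValues j ≤ c := by
  rcases le_or_gt (Module.finrank ℂ E) j with hj | hj
  · rwa [T.singularValues_of_finrank_le hj]
  let b := T.isSymmetric_adjoint_comp_self.eigenvectorBasis rfl
  let ι : Fin (j + 1) → Fin (Module.finrank ℂ E) := Fin.castLE hj
  have hι : Function.Injective ι := Fin.castLE_injective hj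
  let L : (Fin (j + 1) → ℂ) →ₗ[ℂ] E := Fintype.linearCombination ℂ fun i => b (ι i)
  have hL : ∀ a, L a = ∑ i, a i • b (ι i) := fun a => Fintype.linearCombination_apply _ _ _
  have hker : LinearMap.ker (R ∘ₗ L) ≠ ⊥ := by
    intro h0
    have h1 := LinearMap.finrank_range_of_inj (LinearMap.ker_eq_bot.1 h0)
    have h2 := Submodule.finrank_mono (LinearMap.range_comp_le_range L R)
    simp at h1
    omega
  obtain ⟨a, ha, ha0⟩ := Submodule.exists_mem_ne_zero_of_ne_bot hker
  have horth : ∀ i j, inner ℂ (b (ι i)) (b (ι j)) = if i = j then (1 : ℂ) else 0 := by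
    intro i j
    rw [OrthonormalBasis.inner_eq_ite]
    simp [hι.eq_iff]
  have hnorm : ‖L a‖ ^ 2 = ∑ i, ‖a i‖ ^ 2 := by
    have : ((‖L a‖ ^ 2 : ℝ) : ℂ) = ((∑ i, ‖a i‖ ^ 2 : ℝ) : ℂ) := by
      push_cast
      rw [← Complex.coe_algebraMap, ← inner_self_eq_norm_sq_to_K, hL]
      simp only [sum_inner, inner_sum, inner_smul_left, inner_smul_right, horth]
      simp [Complex.mul_conj']
    exact_mod_cast this
  have hTnorm : ‖T (L a)‖ ^ 2 = ∑ i : Fin (j + 1), ‖a i‖ ^ 2 * T.singularValues i ^ 2 := by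
    have : ((‖T (L a)‖ ^ 2 : ℝ) : ℂ) =
        ((∑ i : Fin (j + 1), ‖a i‖ ^ 2 * T.singularValues i ^ 2 : ℝ) : ℂ) := by
      push_cast
      rw [← Complex.coe_algebraMap, ← inner_self_eq_norm_sq_to_K, hL]
      simp only [map_sum, map_smul, sum_inner, inner_sum, inner_smul_left, inner_smul_right]
      refine Finset.sum_congr rfl fun i _ => ?_
      rw [Finset.sum_eq_single i]
      · rw [inner_map_eigenvectorBasis, if_pos rfl]
        simp [ι, ← mul_assoc, Complex.mul_conj']
      · intro l _ hl
        rw [inner_map_eigenvectorBasis, if_neg fun h => hl (hι h)]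
        simp
      · simp
    exact_mod_cast this
  have hpos : 0 < ‖L a‖ ^ 2 := by
    rw [hnorm]
    obtain ⟨i, hi⟩ := Function.ne_iff.1 ha0
    exact Finset.sum_pos' (fun _ _ => by positivity)
      ⟨i, Finset.mem_univ _, by have := norm_pos_iff.2 hi; positivity⟩
  have hlow : T.singularValues j ^ 2 * ‖L a‖ ^ 2 ≤ ‖T (L a)‖ ^ 2 := by
    rw [hnorm, hTnorm, Finset.mul_sum]
    refine Finset.sum_le_sum fun i _ => ?_
    rw [mul_comm]
    have h1 := T.singularValues_antitone (Nat.lt_succ_iff.1 i.2)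
    have h2 := T.singularValues_nonneg j
    gcongr
  have hup : ‖T (L a)‖ ^ 2 ≤ c ^ 2 * ‖L a‖ ^ 2 := by
    rw [← mul_pow]
    have := h (L a) ha
    gcongr
  exact abs_le_of_sq_le_sq' (le_of_mul_le_mul_right (hlow.trans hup) hpos) hc |>.2

end SingularValues

/-! ### Minimal residuals over Krylov spaces -/

section KrylovResidual

/-- If the first Krylov vectors of an injective map are dependent, then GMRES has already
terminated: the initial residual lies in the image of the Krylov space. -/
theorem mem_span_pow_succ_of_not_linearIndependent {E : Type*} [AddCommGroup E] [Module ℂ E]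
    (B : E →ₗ[ℂ] E) (hB : LinearMap.ker B = ⊥) (r : E) (k : ℕ)
    (h : ¬ LinearIndependent ℂ fun j : Fin k => (B ^ (j : ℕ)) r) :
    r ∈ Submodule.span ℂ (Set.range fun j : Fin k => (B ^ ((j : ℕ) + 1)) r) := by
  induction k with
  | zero => exact absurd linearIndependent_empty_type h
  | succ k ih =>
    have hcons : (fun j : Fin (k + 1) => (B ^ (j : ℕ)) r) =
        Fin.cons r fun j : Fin k => (B ^ ((j : ℕ) + 1)) r := by
      ext j
      rcases Fin.eq_zero_or_eq_succ j with rfl | ⟨j, rfl⟩ <;> simp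
    have hr : r ∈ Submodule.span ℂ (Set.range fun j : Fin k => (B ^ ((j : ℕ) + 1)) r) := by
      by_contra hr
      rw [hcons, linearIndependent_finCons, not_and_or, not_not] at h
      refine h.elim (fun h => hr (ih fun hli => h ?_)) hr
      have := hli.map' B hB
      simpa [Function.comp_def, pow_succ', Module.End.mul_apply] using this
    refine Submodule.span_mono ?_ hr
    rintro _ ⟨j, rfl⟩
    exact ⟨j.castSucc, by simp⟩

variable {E : Type*} [NormedAddCommGroup E] [InnerProductSpace ℂ E] [FiniteDimensional ℂ E]

/-- Moret's bound. With `w j = B ^ j r`, the distance of `r` to the span of `w 1, …, w k` is the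
ratio of the volumes of `w 0, …, w k` and `w 1, …, w k`. The first volume equals that of `w 0` and
the differences `(B - 1) (w j)`, hence is at most `‖r‖` times the product of the `s j` times the
volume of `w 0, …, w (k - 1)`; the second is at least `δ ^ k` times that same volume. -/
theorem exists_norm_krylov_residual_le (B : E →ₗ[ℂ] E) {δ : ℝ} (hδ : 0 < δ)
    (hB : ∀ u, δ * ‖u‖ ≤ ‖B u‖) (s : ℕ → ℝ) (hs0 : ∀ j, 0 ≤ s j)
    (hs : ∀ j c, s j < c → ∃ R : E →ₗ[ℂ] E, Module.finrank ℂ (LinearMap.range R) ≤ j ∧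
      ∀ u, ‖B u - u - R u‖ ≤ c * ‖u‖) (r : E) (k : ℕ) :
    ∃ c : Fin k → ℂ, δ ^ k * ‖r - ∑ j, c j • (B ^ ((j : ℕ) + 1)) r‖ ≤
      (∏ j : Fin k, s j) * ‖r‖ := by
  have hP0 : 0 ≤ ∏ j : Fin k, s j := Finset.prod_nonneg fun j _ => hs0 j
  have hBker : LinearMap.ker B = ⊥ := by
    refine LinearMap.ker_eq_bot'.2 fun u hu => ?_
    have := hB u
    rw [hu, norm_zero] at this
    exact norm_le_zero_iff.1 (nonpos_of_mul_nonpos_right this hδ)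
  let w : ℕ → E := fun j => (B ^ j) r
  have hw : ∀ j, w (j + 1) = B (w j) := fun j => by simp [w, pow_succ', Module.End.mul_apply]
  -- In the dependent case the minimal residual is zero.
  by_cases hli : LinearIndependent ℂ fun j : Fin k => w j
  swap
  · obtain ⟨c, hc⟩ := (Submodule.mem_span_range_iff_exists_fun ℂ).1
      (mem_span_pow_succ_of_not_linearIndependent B hBker r k hli)
    refine ⟨c, ?_⟩
    rw [hc, sub_self, norm_zero, mul_zero]
    positivity
  let V := Submodule.span ℂ (Set.range fun j : Fin k => w j)
  have hV : Module.finrank ℂ V = k := by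
    simpa using finrank_span_eq_card hli
  let x : Fin k → V := fun j => ⟨w j, Submodule.subset_span ⟨j, rfl⟩⟩
  have hx : (gram ℂ x).det.re = (gram ℂ fun j : Fin k => w j).det.re := rfl
  have hpos := det_gram_re_pos hli
  rw [← hx] at hpos
  -- The distance from `r` to the span of the `w (j + 1)` is the one sought; the distance to the
  -- span of their differences is only needed to be at most `‖r‖`.
  obtain ⟨c, -, hc⟩ := exists_det_gram_cons r fun j : Fin k => w (j + 1)
  obtain ⟨c', hc'r, hc'⟩ := exists_det_gram_cons r fun j : Fin k => w (j + 1) - w j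
  have hcons : (Fin.cons r fun j : Fin k => w (j + 1) : Fin (k + 1) → E) =
      fun j : Fin (k + 1) => w j := by
    ext j
    rcases Fin.eq_zero_or_eq_succ j with rfl | ⟨j, rfl⟩ <;> simp [w]
  have hvol : (gram ℂ (Fin.cons r fun j : Fin k => w (j + 1) - w j : Fin (k + 1) → E)).det =
      (gram ℂ fun j : Fin (k + 1) => w j).det := det_gram_cons_sub w
  rw [hcons, ← hvol, hc'] at hc
  let T : V →ₗ[ℂ] E := (B - LinearMap.id).domRestrict V
  let S : V →ₗ[ℂ] E := B.domRestrict V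
  have hT : (gram ℂ fun j : Fin k => w (j + 1) - w j).det =
      ((∏ i : Fin k, T.singularValues i : ℝ) ^ 2 : ℝ) * (gram ℂ x).det := by
    rw [← det_gram_map T hV x]
    simp [T, x, hw]
  have hS : (gram ℂ fun j : Fin k => w (j + 1)).det =
      ((∏ i : Fin k, S.singularValues i : ℝ) ^ 2 : ℝ) * (gram ℂ x).det := by
    rw [← det_gram_map S hV x]
    simp [S, x, hw]
  have hTs : ∏ i : Fin k, T.singularValues i ≤ ∏ j : Fin k, s j := by
    refine Finset.prod_le_prod (fun i _ => T.singularValues_nonneg i) fun i _ => ?_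
    refine le_of_forall_gt_imp_ge_of_dense fun a ha => ?_
    obtain ⟨R, hR, hRa⟩ := hs i a ha
    refine singularValues_le_of_finrank_range_le T (R.domRestrict V) i a ((hs0 i).trans ha.le)
      ((Submodule.finrank_mono (LinearMap.range_comp_le_range V.subtype R)).trans hR) fun u hu => ?_
    have hu' : R u = 0 := hu
    simpa [T, hu'] using hRa u
  have hSδ : δ ^ k ≤ ∏ i : Fin k, S.singularValues i := by
    calc δ ^ k = ∏ _i : Fin k, δ := by simp
      _ ≤ _ := Finset.prod_le_prod (fun _ _ => hδ.le) fun i _ =>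
        le_singularValues S (fun u => hB u) hV i
  rw [hT, hS, ← mul_assoc, ← mul_assoc, ← Complex.ofReal_mul, ← Complex.ofReal_mul] at hc
  have hc2 := congrArg Complex.re hc
  rw [Complex.re_ofReal_mul, Complex.re_ofReal_mul] at hc2
  replace hc2 := mul_right_cancel₀ hpos.ne' hc2
  have hT0 : 0 ≤ ∏ i : Fin k, T.singularValues i :=
    Finset.prod_nonneg fun i _ => T.singularValues_nonneg i
  rw [← mul_pow, ← mul_pow] at hc2
  have hδk : 0 < δ ^ k := by positivity
  have hc3 := (sq_eq_sq₀ (by positivity)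
    (mul_nonneg (norm_nonneg _) (hδk.le.trans hSδ))).1 hc2
  refine ⟨c, ?_⟩
  calc δ ^ k * ‖r - ∑ j, c j • (B ^ ((j : ℕ) + 1)) r‖
      ≤ (∏ i : Fin k, S.singularValues i) * ‖r - ∑ j, c j • (B ^ ((j : ℕ) + 1)) r‖ := by gcongr
    _ = ‖r - ∑ i, c' i • (w (i + 1) - w i)‖ * ∏ i : Fin k, T.singularValues i := by
        rw [hc3, mul_comm]
    _ ≤ ‖r‖ * ∏ j : Fin k, s j := by gcongr
    _ = _ := mul_comm _ _

end KrylovResidual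

/-! ### The oblique projection onto the trial space -/

section PetrovGalerkin

variable {H : Type*} [NormedAddCommGroup H] [InnerProductSpace ℂ H]
  {N : ℕ} {Xh Yh : Submodule ℂ H}

/-- If `w` represents the functional `form T u` on the test space, then the supremum in the inf-sup
condition is at most `‖w‖` by Cauchy–Schwarz. -/
theorem DiscreteInfSup.mul_norm_le {T : H →L[ℂ] H} {γ : ℝ} (hT : DiscreteInfSup T Xh Yh γ)
    {u : H} (hu : u ∈ Xh) (w : H) (h : ∀ v ∈ Yh, form T u v = inner ℂ v w) :
    γ * ‖u‖ ≤ ‖w‖ := by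
  refine (hT.2 u hu).trans (Real.iSup_le (fun v => ?_) (norm_nonneg _))
  rw [h v v.2.1, div_le_iff₀ (norm_pos_iff.2 v.2.2), mul_comm]
  exact norm_inner_le_norm _ _

theorem coe_equivFun_symm (φ : Module.Basis (Fin N) ℂ Xh) (c : Fin N → ℂ) :
    ((φ.equivFun.symm c : Xh) : H) = synthesis φ c := by
  simp [synthesis, Module.Basis.equivFun_symm_apply]

theorem galerkinMatrix_mulVec (T : H →L[ℂ] H) (φ : Module.Basis (Fin N) ℂ Xh)
    (ϕ : Module.Basis (Fin N) ℂ Yh) (c : Fin N → ℂ) :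
    galerkinMatrix T φ ϕ *ᵥ c = galerkinVector (T (synthesis φ c)) ϕ := by
  ext i
  simp [galerkinMatrix, galerkinVector, synthesis, mulVec, dotProduct, form, mul_comm]

theorem inner_eq_of_galerkinVector_eq (ϕ : Module.Basis (Fin N) ℂ Yh) {w w' : H}
    (h : galerkinVector w ϕ = galerkinVector w' ϕ) {v : H} (hv : v ∈ Yh) :
    inner ℂ v w = inner ℂ v w' := by
  have hv' : v = ∑ i, ϕ.repr ⟨v, hv⟩ i • (ϕ i : H) := by
    have := congrArg Yh.subtype (ϕ.sum_repr ⟨v, hv⟩)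
    rw [map_sum] at this
    exact this.symm
  rw [hv', sum_inner, sum_inner]
  refine Finset.sum_congr rfl fun i _ => ?_
  rw [inner_smul_left, inner_smul_left]
  exact congrArg _ (congrFun h i)

/-- A coordinate vector in the kernel of the mass matrix represents a trial vector orthogonal to
the test space, which the inf-sup condition forces to vanish. -/
theorem isUnit_det_massMatrix (φ : Module.Basis (Fin N) ℂ Xh) (ϕ : Module.Basis (Fin N) ℂ Yh)
    {γ : ℝ} (h : DiscreteInfSup (ContinuousLinearMap.id ℂ H) Xh Yh γ) :
    IsUnit (massMatrix φ ϕ).det := by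
  rw [isUnit_iff_ne_zero]
  intro h0
  obtain ⟨c, hc0, hc⟩ := exists_mulVec_eq_zero_iff.2 h0
  have hker : γ * ‖synthesis φ c‖ ≤ ‖(0 : H)‖ := by
    refine h.mul_norm_le (by rw [← coe_equivFun_symm]; exact Subtype.coe_prop _) 0 fun v hv => ?_
    refine inner_eq_of_galerkinVector_eq ϕ ?_ hv
    rw [← galerkinMatrix_mulVec]
    refine hc.trans ?_
    ext i
    simp [galerkinVector]
  rw [norm_zero] at hker
  have h1 := norm_le_zero_iff.1 (nonpos_of_mul_nonpos_right hker h.1)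
  rw [← coe_equivFun_symm, Submodule.coe_eq_zero] at h1
  exact hc0 ((LinearEquiv.map_eq_zero_iff _).1 h1)

/-- The oblique projection of `H` onto the trial space along the annihilator of the test space. -/
def petrovProj (φ : Module.Basis (Fin N) ℂ Xh) (ϕ : Module.Basis (Fin N) ℂ Yh) : H →ₗ[ℂ] Xh :=
  φ.equivFun.symm.toLinearMap ∘ₗ (massMatrix φ ϕ)⁻¹.mulVecLin ∘ₗ
    LinearMap.pi fun i => (innerSL ℂ (ϕ i : H)).toLinearMap

theorem petrovProj_apply (φ : Module.Basis (Fin N) ℂ Xh) (ϕ : Module.Basis (Fin N) ℂ Yh) (w : H) :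
    petrovProj φ ϕ w = φ.equivFun.symm ((massMatrix φ ϕ)⁻¹ *ᵥ galerkinVector w ϕ) := rfl

variable (φ : Module.Basis (Fin N) ℂ Xh) (ϕ : Module.Basis (Fin N) ℂ Yh)

theorem inner_petrovProj {γ : ℝ}
    (h : DiscreteInfSup (ContinuousLinearMap.id ℂ H) Xh Yh γ) (w : H) {v : H} (hv : v ∈ Yh) :
    inner ℂ v (petrovProj φ ϕ w : H) = inner ℂ v w := by
  refine inner_eq_of_galerkinVector_eq ϕ ?_ hv
  have h1 := galerkinMatrix_mulVec (ContinuousLinearMap.id ℂ H) φ ϕ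
    ((massMatrix φ ϕ)⁻¹ *ᵥ galerkinVector w ϕ)
  rw [petrovProj_apply, coe_equivFun_symm]
  refine h1.symm.trans ?_
  change massMatrix φ ϕ *ᵥ _ = _
  rw [mulVec_mulVec, mul_nonsing_inv _ (isUnit_det_massMatrix φ ϕ h), one_mulVec]

theorem mul_norm_petrovProj_le {γ : ℝ}
    (h : DiscreteInfSup (ContinuousLinearMap.id ℂ H) Xh Yh γ) (w : H) : γ * ‖petrovProj φ ϕ w‖ ≤ ‖w‖ :=
  h.mul_norm_le (petrovProj φ ϕ w).2 w fun _ hv => inner_petrovProj φ ϕ h w hv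

theorem petrovProj_coe {γ : ℝ}
    (h : DiscreteInfSup (ContinuousLinearMap.id ℂ H) Xh Yh γ) (u : Xh) : petrovProj φ ϕ (u : H) = u := by
  have h1 : γ * ‖((petrovProj φ ϕ (u : H) - u : Xh) : H)‖ ≤ ‖(0 : H)‖ := by
    refine h.mul_norm_le (Subtype.coe_prop _) 0 fun v hv => ?_
    simp [form, inner_petrovProj φ ϕ h _ hv]
  rw [norm_zero] at h1
  have h2 := norm_le_zero_iff.1 (nonpos_of_mul_nonpos_right h1 h.1)
  rw [Submodule.coe_eq_zero] at h2
  exact sub_eq_zero.1 h2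

end PetrovGalerkin

/-! ### The weighted norm and the synthesis operator -/

section EnergyNorm

variable {H : Type*} [NormedAddCommGroup H] [InnerProductSpace ℂ H]
  {N : ℕ} {Xh : Submodule ℂ H} (φ : Module.Basis (Fin N) ℂ Xh)

theorem energyNorm_eq (u : Fin N → ℂ) : energyNorm φ u = ‖synthesis φ u‖ := by
  have h1 : massMatrix φ φ = gram ℂ fun i => (φ i : H) := rfl
  have h2 := star_dotProduct_gram_mulVec (𝕜 := ℂ) (fun i => (φ i : H)) u u
  rw [energyNorm, h1]
  change Real.sqrt (star u ⬝ᵥ gram ℂ (fun i => (φ i : H)) *ᵥ u).re = _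
  rw [h2, ← synthesis]
  exact (norm_eq_sqrt_re_inner (𝕜 := ℂ) _).symm

/-- The synthesis operator as a linear isomorphism from Euclidean space onto the trial space. -/
def synthesisEquiv : EuclideanSpace ℂ (Fin N) ≃ₗ[ℂ] Xh :=
  (WithLp.linearEquiv 2 ℂ (Fin N → ℂ)).trans φ.equivFun.symm

theorem norm_synthesisEquiv (u : Fin N → ℂ) :
    ‖synthesisEquiv φ (WithLp.toLp 2 u)‖ = ‖synthesis φ u‖ := by
  rw [← coe_equivFun_symm]
  rfl

theorem euclideanNorm_pos {u : Fin N → ℂ} (hu : u ≠ 0) : 0 < euclideanNorm u := by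
  simpa [euclideanNorm] using hu

theorem bddAbove_synthesis : BddAbove (Set.range fun u : {u : Fin N → ℂ // u ≠ 0} =>
    ‖synthesis φ u‖ / euclideanNorm (u : Fin N → ℂ)) := by
  let L := LinearMap.toContinuousLinearMap (synthesisEquiv φ).toLinearMap
  refine ⟨‖L‖, ?_⟩
  rintro _ ⟨u, rfl⟩
  rw [div_le_iff₀ (euclideanNorm_pos u.2), ← norm_synthesisEquiv]
  exact L.le_opNorm _

theorem bddBelow_synthesis : BddBelow (Set.range fun u : {u : Fin N → ℂ // u ≠ 0} =>
    ‖synthesis φ u‖ / euclideanNorm (u : Fin N → ℂ)) := by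
  refine ⟨0, ?_⟩
  rintro _ ⟨u, rfl⟩
  exact div_nonneg (norm_nonneg _) (norm_nonneg _)

theorem norm_synthesis_le {u : Fin N → ℂ} (hu : u ≠ 0) :
    ‖synthesis φ u‖ ≤ synthesisNorm φ * euclideanNorm u := by
  rw [← div_le_iff₀ (euclideanNorm_pos hu)]
  exact le_ciSup (bddAbove_synthesis φ) ⟨u, hu⟩

theorem synthesisGamma_mul_le {u : Fin N → ℂ} (hu : u ≠ 0) :
    synthesisGamma φ * euclideanNorm u ≤ ‖synthesis φ u‖ := by
  rw [← le_div_iff₀ (euclideanNorm_pos hu)]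
  exact ciInf_le (bddBelow_synthesis φ) ⟨u, hu⟩

/-- The synthesis operator is an isomorphism of finite-dimensional spaces, so its inverse is
bounded. -/
theorem synthesisGamma_pos (hN : 0 < N) : 0 < synthesisGamma φ := by
  have : Nonempty (Fin N) := ⟨⟨0, hN⟩⟩
  have : Nonempty {u : Fin N → ℂ // u ≠ 0} := ⟨⟨1, one_ne_zero⟩⟩
  have : FiniteDimensional ℂ Xh := φ.finiteDimensional_of_finite
  let L := LinearMap.toContinuousLinearMap (synthesisEquiv φ).symm.toLinearMap
  have hL : ∀ u : Fin N → ℂ, euclideanNorm u ≤ (‖L‖ + 1) * ‖synthesis φ u‖ := by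
    intro u
    have h1 := L.le_opNorm (synthesisEquiv φ (WithLp.toLp 2 u))
    have h2 : L (synthesisEquiv φ (WithLp.toLp 2 u)) = WithLp.toLp 2 u :=
      (synthesisEquiv φ).symm_apply_apply _
    rw [h2, norm_synthesisEquiv] at h1
    refine h1.trans ?_
    gcongr
    linarith
  have hL0 : 0 < ‖L‖ + 1 := by positivity
  refine (inv_pos.2 hL0).trans_le (le_ciInf fun u => ?_)
  rw [le_div_iff₀ (euclideanNorm_pos u.2), inv_mul_le_iff₀ hL0]
  exact hL u

theorem one_le_synthesisCond (hN : 0 < N) : 1 ≤ synthesisCond φ := by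
  have : Nonempty (Fin N) := ⟨⟨0, hN⟩⟩
  have h1 : (1 : Fin N → ℂ) ≠ 0 := one_ne_zero
  rw [synthesisCond, one_le_div (synthesisGamma_pos φ hN)]
  exact le_of_mul_le_mul_right ((synthesisGamma_mul_le φ h1).trans (norm_synthesis_le φ h1))
    (euclideanNorm_pos h1)

end EnergyNorm

/-! ### Geometric, arithmetic and power means -/

section Means

theorem prod_rpow_le_mean {k : ℕ} (hk : 1 ≤ k) (a : ℕ → ℝ) (ha : ∀ j, 0 ≤ a j) :
    (∏ j ∈ Finset.range k, a j) ^ (1 / (k : ℝ)) ≤ 1 / (k : ℝ) * ∑ j ∈ Finset.range k, a j := by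
  have hk0 : (0 : ℝ) < k := by exact_mod_cast hk
  have := Real.geom_mean_le_arith_mean (Finset.range k) (fun _ => 1) a (fun _ _ => zero_le_one)
    (by simpa [Nat.pos_iff_ne_zero] using hk0) (fun j _ => ha j)
  simpa [div_eq_inv_mul] using this

theorem prod_rpow_le_rpow_mean {k : ℕ} (hk : 1 ≤ k) (a : ℕ → ℝ) (ha : ∀ j, 0 ≤ a j) {p : ℝ}
    (hp : 0 < p) :
    (∏ j ∈ Finset.range k, a j) ^ (1 / (k : ℝ)) ≤
      (1 / (k : ℝ) * ∑ j ∈ Finset.range k, a j ^ p) ^ (1 / p) := by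
  have hP : 0 ≤ ∏ j ∈ Finset.range k, a j := Finset.prod_nonneg fun j _ => ha j
  have h1 := prod_rpow_le_mean hk (fun j => a j ^ p) fun j => Real.rpow_nonneg (ha j) p
  rw [Real.finsetProd_rpow _ _ fun j _ => ha j, ← Real.rpow_mul hP] at h1
  calc (∏ j ∈ Finset.range k, a j) ^ (1 / (k : ℝ))
      = ((∏ j ∈ Finset.range k, a j) ^ (p * (1 / (k : ℝ)))) ^ (1 / p) := by
        rw [← Real.rpow_mul hP]
        congr 1
        field_simp
    _ ≤ _ := Real.rpow_le_rpow (Real.rpow_nonneg hP _) h1 (by positivity)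

theorem mean_le_rpow_mean {k : ℕ} (hk : 1 ≤ k) (a : ℕ → ℝ) (ha : ∀ j, 0 ≤ a j) {p : ℝ}
    (hp : 1 ≤ p) :
    1 / (k : ℝ) * ∑ j ∈ Finset.range k, a j ≤
      (1 / (k : ℝ) * ∑ j ∈ Finset.range k, a j ^ p) ^ (1 / p) := by
  have hk0 : (k : ℝ) ≠ 0 := by exact_mod_cast (by omega : k ≠ 0)
  have := Real.arith_mean_le_rpow_mean (Finset.range k) (fun _ => 1 / (k : ℝ)) a
    (fun _ _ => by positivity) (by simp [hk0]) (fun j _ => ha j) hp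
  rwa [← Finset.mul_sum, ← Finset.mul_sum] at this

theorem rpow_one_div_le_of_le_prod_div {k : ℕ} (hk : 1 ≤ k) (a : ℕ → ℝ) (ha : ∀ j, 0 ≤ a j)
    {ρ γ : ℝ} (hρ : 0 ≤ ρ) (hγ : 0 < γ) (h : ρ ≤ ∏ j ∈ Finset.range k, a j / γ) :
    ρ ^ (1 / (k : ℝ)) ≤ (∏ j ∈ Finset.range k, a j) ^ (1 / (k : ℝ)) / γ := by
  refine (Real.rpow_le_rpow hρ h (by positivity)).trans_eq ?_
  rw [Finset.prod_div_distrib, Finset.prod_const, Finset.card_range,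
    Real.div_rpow (Finset.prod_nonneg fun j _ => ha j) (by positivity), one_div,
    Real.pow_rpow_inv_natCast hγ.le (by omega)]

end Means

/-! ### Approximation numbers of bounded operators -/

section ApproximationNumbers

variable {H : Type*} [NormedAddCommGroup H] [InnerProductSpace ℂ H]

theorem singularValue_nonneg (T : H →L[ℂ] H) (j : ℕ) : 0 ≤ singularValue T j :=
  Real.sInf_nonneg (by rintro _ ⟨F, -, rfl⟩; exact norm_nonneg _)

theorem exists_norm_sub_lt (T : H →L[ℂ] H) (j : ℕ) {c : ℝ} (h : singularValue T (j + 1) < c) :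
    ∃ F : H →L[ℂ] H, (F : H →ₗ[ℂ] H).rank < ((j + 1 : ℕ) : Cardinal) ∧ ‖T - F‖ < c := by
  have hne : {r : ℝ | ∃ F : H →L[ℂ] H, (F : H →ₗ[ℂ] H).rank < ((j + 1 : ℕ) : Cardinal) ∧
      r = ‖T - F‖}.Nonempty :=
    ⟨_, 0, by
      rw [ContinuousLinearMap.toLinearMap_zero, LinearMap.rank_zero]
      exact_mod_cast j.succ_pos, rfl⟩
  obtain ⟨_, ⟨F, hF, rfl⟩, hlt⟩ := exists_lt_of_csInf_lt hne h
  exact ⟨F, hF, hlt⟩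

theorem meanSingularValue_eq (T : H →L[ℂ] H) (k : ℕ) :
    meanSingularValue T k = 1 / (k : ℝ) * ∑ j ∈ Finset.range k, singularValue T (j + 1) := by
  rw [meanSingularValue, Finset.range_eq_Ico, Finset.sum_Ico_add' (singularValue T) 0 k 1]
  rfl

theorem rpow_mean_le_carlemanNorm (T : H →L[ℂ] H) {p : ℝ} (hp : 0 < p) (hT : IsCarleman p T)
    (k : ℕ) :
    (1 / (k : ℝ) * ∑ j ∈ Finset.range k, singularValue T (j + 1) ^ p) ^ (1 / p) ≤
      carlemanNorm p T * (k : ℝ) ^ (-(1 / p)) := by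
  have h0 : ∀ j, 0 ≤ singularValue T (j + 1) ^ p := fun j =>
    Real.rpow_nonneg (singularValue_nonneg T _) p
  rw [Real.mul_rpow (by positivity) (Finset.sum_nonneg fun j _ => h0 j), mul_comm, carlemanNorm,
    Real.rpow_neg (Nat.cast_nonneg k), one_div (k : ℝ), Real.inv_rpow (Nat.cast_nonneg k)]
  refine mul_le_mul_of_nonneg_right ?_ (by positivity)
  exact Real.rpow_le_rpow (Finset.sum_nonneg fun j _ => h0 j)
    ((hT.2 hp).sum_le_tsum _ fun j _ => h0 j) (by positivity)

end ApproximationNumbers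

/-! ### Residuals of the Galerkin system -/

section Galerkin

variable {H : Type*} [NormedAddCommGroup H] [InnerProductSpace ℂ H]
  {N : ℕ} {Xh Yh : Submodule ℂ H}

/-- The operator on the trial space that the preconditioned Galerkin matrix represents. -/
def petrovOp (A : H →L[ℂ] H) (φ : Module.Basis (Fin N) ℂ Xh) (ϕ : Module.Basis (Fin N) ℂ Yh) :
    Xh →ₗ[ℂ] Xh :=
  petrovProj φ ϕ ∘ₗ A.toLinearMap ∘ₗ Xh.subtype

theorem petrovOp_pow_equivFun_symm (A : H →L[ℂ] H) (φ : Module.Basis (Fin N) ℂ Xh)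
    (ϕ : Module.Basis (Fin N) ℂ Yh) (c : Fin N → ℂ) (j : ℕ) :
    (petrovOp A φ ϕ ^ j) (φ.equivFun.symm c) =
      φ.equivFun.symm ((((massMatrix φ ϕ)⁻¹ * galerkinMatrix A φ ϕ) ^ j) *ᵥ c) := by
  induction j with
  | zero => simp
  | succ j ih =>
    rw [pow_succ', Module.End.mul_apply, ih, pow_succ', ← mulVec_mulVec, ← mulVec_mulVec,
      galerkinMatrix_mulVec, ← coe_equivFun_symm]
    rfl

/-- Moret's bound for the Galerkin system. If `F` approximates `K = A - 1`, then `P F` on the trial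
space approximates `P K` with no larger rank, at the cost of the bound `1 / γN` for the norm of the
oblique projection `P`. -/
theorem exists_energy_residual_le (A : H →L[ℂ] H) (φ : Module.Basis (Fin N) ℂ Xh)
    (ϕ : Module.Basis (Fin N) ℂ Yh) {γA γN : ℝ} (hγA : DiscreteInfSup A Xh Yh γA)
    (hγN : DiscreteInfSup (ContinuousLinearMap.id ℂ H) Xh Yh γN) (r : Fin N → ℂ) (k : ℕ) :
    ∃ c : Fin k → ℂ, ‖synthesis φ (r - ∑ j, c j •
        (((massMatrix φ ϕ)⁻¹ * galerkinMatrix A φ ϕ) ^ ((j : ℕ) + 1)) *ᵥ r)‖ ≤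
      (∏ j ∈ Finset.range k,
        singularValue (A - ContinuousLinearMap.id ℂ H) (j + 1) / (γA * γN)) * ‖synthesis φ r‖ := by
  have : FiniteDimensional ℂ Xh := φ.finiteDimensional_of_finite
  have hA0 := hγA.1
  have hN0 := hγN.1
  set K := A - ContinuousLinearMap.id ℂ H with hK
  obtain ⟨c, hc⟩ := exists_norm_krylov_residual_le (petrovOp A φ ϕ) hγA.1
    (fun u => hγA.mul_norm_le u.2 (petrovOp A φ ϕ u) fun v hv =>
      (inner_petrovProj φ ϕ hγN (A u) hv).symm)
    (fun j => singularValue K (j + 1) / γN)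
    (fun j => div_nonneg (singularValue_nonneg K _) hγN.1.le)
    (fun j c hc => by
      rw [div_lt_iff₀ hγN.1] at hc
      obtain ⟨F, hF, hFc⟩ := exists_norm_sub_lt K j hc
      refine ⟨petrovProj φ ϕ ∘ₗ F.toLinearMap ∘ₗ Xh.subtype, ?_, fun u => ?_⟩
      · refine Nat.lt_succ_iff.1 (Module.finrank_lt_of_rank_lt ?_)
        exact (LinearMap.rank_comp_le_right _ _).trans_lt
          ((LinearMap.rank_comp_le_left _ _).trans_lt hF)
      · have h1 : petrovOp A φ ϕ u - u - (petrovProj φ ϕ ∘ₗ F.toLinearMap ∘ₗ Xh.subtype) u =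
            petrovProj φ ϕ ((K - F) u) := by
          nth_rewrite 2 [← petrovProj_coe φ ϕ hγN u]
          simp [petrovOp, hK]
        rw [h1]
        have h2 := mul_norm_petrovProj_le φ ϕ hγN ((K - F) u)
        have h3 : ‖(K - F) u‖ ≤ c * γN * ‖u‖ :=
          ((K - F).le_opNorm u).trans (mul_le_mul_of_nonneg_right hFc.le (norm_nonneg _))
        refine le_of_mul_le_mul_left ?_ hγN.1
        linarith)
    (φ.equivFun.symm r) k
  refine ⟨c, ?_⟩
  have hsum : φ.equivFun.symm r - ∑ j, c j • (petrovOp A φ ϕ ^ ((j : ℕ) + 1))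
      (φ.equivFun.symm r) = φ.equivFun.symm (r - ∑ j, c j •
        (((massMatrix φ ϕ)⁻¹ * galerkinMatrix A φ ϕ) ^ ((j : ℕ) + 1)) *ᵥ r) := by
    simp_rw [petrovOp_pow_equivFun_symm]
    simp only [map_sub, map_sum, map_smul]
  rw [hsum, ← Submodule.norm_coe, ← Submodule.norm_coe, coe_equivFun_symm, coe_equivFun_symm,
    Fin.prod_univ_eq_prod_range (fun j => singularValue K (j + 1) / γN) k] at hc
  have hprod : ∏ j ∈ Finset.range k, singularValue K (j + 1) / (γA * γN) =
      (∏ j ∈ Finset.range k, singularValue K (j + 1) / γN) / γA ^ k := by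
    simp_rw [mul_comm γA γN, ← div_div, Finset.prod_div_distrib _ fun _ => γA, Finset.prod_const,
      Finset.card_range]
  rw [hprod, div_mul_eq_mul_div, le_div_iff₀ (by positivity), mul_comm]
  exact hc

/-- The competitors are the residuals of `x₀ + ∑ j, c j • Q ^ j r₀`. -/
theorem IsGmresIterate.le {nrm : (Fin N → ℂ) → ℝ} {Q : Matrix (Fin N) (Fin N) ℂ}
    {d x₀ x : Fin N → ℂ} {k : ℕ} (hx : IsGmresIterate nrm Q d x₀ k x) (c : Fin k → ℂ) :
    nrm (residual Q d x) ≤ nrm (residual Q d x₀ -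
      ∑ j, c j • (Q ^ ((j : ℕ) + 1)) *ᵥ residual Q d x₀) := by
  refine (hx.2 (x₀ + ∑ j, c j • (Q ^ (j : ℕ)) *ᵥ residual Q d x₀) ?_).trans_eq ?_
  · rw [add_sub_cancel_left]
    exact Submodule.sum_mem _ fun j _ => Submodule.smul_mem _ _
      (Submodule.subset_span ⟨j, j.2, rfl⟩)
  · congr 1
    conv_lhs => rw [residual]
    rw [mulVec_add, mulVec_sum, ← sub_sub, ← residual]
    simp only [mulVec_smul, mulVec_mulVec, pow_succ']

/-- The Euclidean iterate beats the weighted one in the Euclidean norm, and the two norms are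
equivalent with the bounds of the synthesis operator. -/
theorem IsGmresIterate.euclidean_ratio_le (φ : Module.Basis (Fin N) ℂ Xh)
    {Q : Matrix (Fin N) (Fin N) ℂ} {d x₀ x y : Fin N → ℂ} {k : ℕ} (hN : 0 < N)
    (hx₀ : residual Q d x₀ ≠ 0) (hx : IsGmresIterate (energyNorm φ) Q d x₀ k x)
    (hy : IsGmresIterate euclideanNorm Q d x₀ k y) :
    euclideanNorm (residual Q d y) / euclideanNorm (residual Q d x₀) ≤
      synthesisCond φ *
        (energyNorm φ (residual Q d x) / energyNorm φ (residual Q d x₀)) := by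
  have hγ := synthesisGamma_pos φ hN
  have h0 := euclideanNorm_pos hx₀
  have hs0 : 0 < ‖synthesis φ (residual Q d x₀)‖ :=
    (mul_pos hγ h0).trans_le (synthesisGamma_mul_le φ hx₀)
  have h1 : synthesisGamma φ * euclideanNorm (residual Q d y) ≤
      ‖synthesis φ (residual Q d x)‖ := by
    refine (mul_le_mul_of_nonneg_left (hy.2 x hx.1) hγ.le).trans ?_
    rcases eq_or_ne (residual Q d x) 0 with h | h
    · simp [h, euclideanNorm]
    · exact synthesisGamma_mul_le φ h
  have h2 := norm_synthesis_le φ hx₀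
  rw [energyNorm_eq, energyNorm_eq, synthesisCond, div_mul_div_comm, div_le_div_iff₀ h0
    (by positivity)]
  calc euclideanNorm (residual Q d y) * (synthesisGamma φ * ‖synthesis φ (residual Q d x₀)‖)
      = (synthesisGamma φ * euclideanNorm (residual Q d y)) *
          ‖synthesis φ (residual Q d x₀)‖ := by ring
    _ ≤ ‖synthesis φ (residual Q d x)‖ *
          (synthesisNorm φ * euclideanNorm (residual Q d x₀)) := by gcongr
    _ = _ := by ring

end Galerkin

end BiParam

end

/-! ### Convergence bounds for GMRES -/

theorem mainTheorem7 {H : Type*} [NormedAddCommGroup H] [InnerProductSpace ℂ H] [CompleteSpace H]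
    (p : ℝ) (hp : 0 ≤ p)
    (A K : H →L[ℂ] H) (hA : BiParam.IsSecondKind p A) (hK : K = A - ContinuousLinearMap.id ℂ H)
    (N : ℕ) (Xh Yh : Submodule ℂ H)
    (φ : Module.Basis (Fin N) ℂ Xh) (ϕ : Module.Basis (Fin N) ℂ Yh)
    (γA γN : ℝ) (hγA : BiParam.DiscreteInfSup A Xh Yh γA)
    (hγN : BiParam.DiscreteInfSup (ContinuousLinearMap.id ℂ H) Xh Yh γN)
    (b : H) (Q : Matrix (Fin N) (Fin N) ℂ) (d : Fin N → ℂ)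
    (hQ : Q = (BiParam.massMatrix φ ϕ)⁻¹ * BiParam.galerkinMatrix A φ ϕ)
    (hd : d = ((BiParam.massMatrix φ ϕ)⁻¹).mulVec (BiParam.galerkinVector b ϕ))
    (x₀ : Fin N → ℂ) (hx₀ : BiParam.residual Q d x₀ ≠ 0)
    (k : ℕ) (hk : 1 ≤ k) (hkN : k ≤ N)
    (x y : Fin N → ℂ)
    (hx : BiParam.IsGmresIterate (BiParam.energyNorm φ) Q d x₀ k x)
    (hy : BiParam.IsGmresIterate BiParam.euclideanNorm Q d x₀ k y) :
    -- weighted GMRES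
    ((BiParam.energyNorm φ (BiParam.residual Q d x) /
          BiParam.energyNorm φ (BiParam.residual Q d x₀)) ^ (1 / (k : ℝ)) ≤
        BiParam.meanSingularValue K k / (γA * γN) ∧
      (0 < p →
        (BiParam.energyNorm φ (BiParam.residual Q d x) /
            BiParam.energyNorm φ (BiParam.residual Q d x₀)) ^ (1 / (k : ℝ)) ≤
          BiParam.carlemanNorm p K / (γA * γN) * (k : ℝ) ^ (-(1 / p))) ∧
      (1 ≤ p →
        BiParam.meanSingularValue K k / (γA * γN) ≤
          BiParam.carlemanNorm p K / (γA * γN) * (k : ℝ) ^ (-(1 / p)))) ∧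
    -- Euclidean GMRES
    ((BiParam.euclideanNorm (BiParam.residual Q d y) /
          BiParam.euclideanNorm (BiParam.residual Q d x₀)) ^ (1 / (k : ℝ)) ≤
        BiParam.synthesisCond φ * (BiParam.meanSingularValue K k / (γA * γN)) ∧
      (0 < p →
        (BiParam.euclideanNorm (BiParam.residual Q d y) /
            BiParam.euclideanNorm (BiParam.residual Q d x₀)) ^ (1 / (k : ℝ)) ≤
          BiParam.synthesisCond φ *
            (BiParam.carlemanNorm p K / (γA * γN)) * (k : ℝ) ^ (-(1 / p))) ∧
      (1 ≤ p →
        BiParam.synthesisCond φ * (BiParam.meanSingularValue K k / (γA * γN)) ≤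
          BiParam.synthesisCond φ *
            (BiParam.carlemanNorm p K / (γA * γN)) * (k : ℝ) ^ (-(1 / p)))) := by
  have hKC : BiParam.IsCarleman p K := hK ▸ hA
  have hN : 0 < N := by omega
  have hγ : 0 < γA * γN := mul_pos hγA.1 hγN.1
  have hσ : ∀ j, 0 ≤ BiParam.singularValue K (j + 1) := fun j => BiParam.singularValue_nonneg K _
  have he0 : 0 < BiParam.energyNorm φ (BiParam.residual Q d x₀) := by
    rw [BiParam.energyNorm_eq]
    exact (mul_pos (BiParam.synthesisGamma_pos φ hN) (BiParam.euclideanNorm_pos hx₀)).trans_le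
      (BiParam.synthesisGamma_mul_le φ hx₀)
  have hκ := BiParam.one_le_synthesisCond φ hN
  set κ := BiParam.synthesisCond φ
  set ρ := BiParam.energyNorm φ (BiParam.residual Q d x) /
    BiParam.energyNorm φ (BiParam.residual Q d x₀) with hρ_def
  have hρ0 : 0 ≤ ρ := div_nonneg (Real.sqrt_nonneg _) he0.le
  have hρ : ρ ≤ ∏ j ∈ Finset.range k, BiParam.singularValue K (j + 1) / (γA * γN) := by
    obtain ⟨c, hc⟩ :=
      BiParam.exists_energy_residual_le A φ ϕ hγA hγN (BiParam.residual Q d x₀) k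
    rw [hρ_def, div_le_iff₀ he0]
    refine (hx.le c).trans ?_
    rw [BiParam.energyNorm_eq, BiParam.energyNorm_eq, hK]
    rwa [← hQ] at hc
  have hgeom := BiParam.rpow_one_div_le_of_le_prod_div hk _ hσ hρ0 hγ hρ
  have hw1 : ρ ^ (1 / (k : ℝ)) ≤ BiParam.meanSingularValue K k / (γA * γN) := by
    refine hgeom.trans ?_
    rw [BiParam.meanSingularValue_eq]
    exact div_le_div_of_nonneg_right (BiParam.prod_rpow_le_mean hk _ hσ) hγ.le
  have hw2 : 0 < p → ρ ^ (1 / (k : ℝ)) ≤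
      BiParam.carlemanNorm p K / (γA * γN) * (k : ℝ) ^ (-(1 / p)) := fun hp0 => by
    refine hgeom.trans ?_
    rw [div_mul_eq_mul_div]
    exact div_le_div_of_nonneg_right ((BiParam.prod_rpow_le_rpow_mean hk _ hσ hp0).trans
      (BiParam.rpow_mean_le_carlemanNorm K hp0 hKC k)) hγ.le
  have hw3 : 1 ≤ p → BiParam.meanSingularValue K k / (γA * γN) ≤
      BiParam.carlemanNorm p K / (γA * γN) * (k : ℝ) ^ (-(1 / p)) := fun hp1 => by
    rw [div_mul_eq_mul_div, BiParam.meanSingularValue_eq]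
    exact div_le_div_of_nonneg_right ((BiParam.mean_le_rpow_mean hk _ hσ hp1).trans
      (BiParam.rpow_mean_le_carlemanNorm K (by linarith) hKC k)) hγ.le
  have hκ0 : 0 ≤ κ := zero_le_one.trans hκ
  have hk1 : 1 / (k : ℝ) ≤ 1 := by
    rw [one_div]
    exact inv_le_one_of_one_le₀ (by exact_mod_cast hk)
  have heucl : (BiParam.euclideanNorm (BiParam.residual Q d y) /
      BiParam.euclideanNorm (BiParam.residual Q d x₀)) ^ (1 / (k : ℝ)) ≤
      κ * ρ ^ (1 / (k : ℝ)) := by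
    refine (Real.rpow_le_rpow (div_nonneg (norm_nonneg _) (norm_nonneg _))
      (BiParam.IsGmresIterate.euclidean_ratio_le φ hN hx₀ hx hy) (by positivity)).trans ?_
    rw [Real.mul_rpow hκ0 hρ0]
    -- Since `κ ≥ 1`, its `k`-th root is at most `κ`.
    exact mul_le_mul_of_nonneg_right (Real.rpow_le_self_of_one_le hκ hk1)
      (Real.rpow_nonneg hρ0 _)
  refine ⟨⟨hw1, hw2, hw3⟩, heucl.trans (mul_le_mul_of_nonneg_left hw1 hκ0), fun hp0 => ?_,
    fun hp1 => ?_⟩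
  · rw [mul_assoc]
    exact heucl.trans (mul_le_mul_of_nonneg_left (hw2 hp0) hκ0)
  · rw [mul_assoc]
    exact mul_le_mul_of_nonneg_left (hw3 hp1) hκ0
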